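/- For positive integers $n$ let $H_n=\sum_{k=1}^n \frac1k$ and $H_n^{(2)}=\sum_{k=1}^n\frac1{k^2}$, and let $\zeta$ denote the Riemann zeta function. Then the series below converges (as the limit of its partial sums) and $$\sum_{n=1}^\infty \frac{(-1)^{n-1}\left(H_n^2+H_n^{(2)}\right)}{n}=\frac74\,\zeta(3)-\zeta(2)\log 2+\frac13\log^3 2 .$$ -/

import Mathlib

open Filter Topology

/-- The generalized harmonic number `H_n^{(r)} = ∑_{k=1}^n 1 / k^r`. -/
noncomputable def generalizedHarmonic (r n : ℕ) : ℝ :=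
  ∑ k ∈ Finset.Icc 1 n, 1 / (k : ℝ) ^ r

/-- For `r = 1` this is the ordinary harmonic number. -/
theorem generalizedHarmonic_one (n : ℕ) :
    generalizedHarmonic 1 n = ((harmonic n : ℚ) : ℝ) := by
  simp [generalizedHarmonic, harmonic_eq_sum_Icc]

/-! Repeated integration by parts turns `(H_n² + H_n^{(2)})/n` into the log-moment `∫₀¹ (1-t)^{n-1}
log² t dt`. Summing with alternating signs gives the geometric series of `t - 1`, so the sum is `∫₀¹
log² t / (2-t) dt`; expanding the same kernel in powers of `t/2` identifies it as `2 Li₃(1/2)`.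

The value of `Li₃(1/2)` comes from the three-term relation between `Li₃` at `x`, `1-x` and
`-x/(1-x)`, whose arguments at `x = 1/2` are `1/2`, `1/2`, `-1`, together with `Li₃(-1) = -(3/4)
ζ(3)`. Each functional equation holds because a combination has zero derivative inside the interval
and is continuous up to its ends. -/

/-! ### Polylogarithms on `[-1, 1]` -/

/-- The real polylogarithm series `∑ x ^ n / n ^ s` over `n ≥ 1`. -/
noncomputable def realPolylog (s : ℕ) (x : ℝ) : ℝ :=
  ∑' n : ℕ, x ^ (n + 1) / ((n : ℝ) + 1) ^ s

theorem realPolylog_zero_right (s : ℕ) : realPolylog s 0 = 0 := by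
  simp [realPolylog]

theorem realPolylog_one_left {x : ℝ} (hx : |x| < 1) :
    realPolylog 1 x = -Real.log (1 - x) := by
  simpa [realPolylog] using (Real.hasSum_pow_div_log_of_abs_lt_one hx).tsum_eq

theorem summable_one_div_succ_pow {s : ℕ} (hs : 2 ≤ s) :
    Summable fun n : ℕ => 1 / ((n : ℝ) + 1) ^ s := by
  have h := (summable_nat_add_iff 1).2 (Real.summable_one_div_nat_pow.2 (show 1 < s by omega))
  simpa using h

theorem norm_realPolylog_term_le (s n : ℕ) {x : ℝ} (hx : |x| ≤ 1) :
    ‖x ^ (n + 1) / ((n : ℝ) + 1) ^ s‖ ≤ 1 / ((n : ℝ) + 1) ^ s := by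
  have h0 : (0 : ℝ) < ((n : ℝ) + 1) ^ s := by positivity
  rw [norm_div, norm_pow, Real.norm_eq_abs, Real.norm_eq_abs, abs_of_pos h0]
  gcongr
  exact pow_le_one₀ (abs_nonneg x) hx

theorem summable_realPolylog {s : ℕ} (hs : 2 ≤ s) {x : ℝ} (hx : |x| ≤ 1) :
    Summable fun n : ℕ => x ^ (n + 1) / ((n : ℝ) + 1) ^ s :=
  Summable.of_norm_bounded (summable_one_div_succ_pow hs)
    fun n => norm_realPolylog_term_le s n hx

theorem continuousOn_realPolylog {s : ℕ} (hs : 2 ≤ s) :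
    ContinuousOn (realPolylog s) (Set.Icc (-1) 1) := by
  refine continuousOn_tsum (fun n => by fun_prop) (summable_one_div_succ_pow hs) ?_
  intro n x hx
  exact norm_realPolylog_term_le s n (abs_le.2 hx)

theorem hasDerivAt_realPolylog_succ {s : ℕ} (hs : 1 ≤ s) {x : ℝ} (hx : |x| < 1) (hx0 : x ≠ 0) :
    HasDerivAt (realPolylog (s + 1)) (realPolylog s x / x) x := by
  -- On the ball of radius `r` the differentiated terms are dominated by `r ^ n`.
  obtain ⟨r, hxr, hr⟩ := exists_between hx
  have hr0 : 0 ≤ r := (abs_nonneg x).trans hxr.le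
  have hmem : ∀ {y : ℝ}, y ∈ Metric.ball (0 : ℝ) r → |y| < r := fun hy => by
    simpa using hy
  have key : HasDerivAt (realPolylog (s + 1)) (∑' n : ℕ, x ^ n / ((n : ℝ) + 1) ^ s) x := by
    refine hasDerivAt_tsum_of_isPreconnected (t := Metric.ball (0 : ℝ) r) (y₀ := x)
      (g := fun (n : ℕ) (y : ℝ) => y ^ (n + 1) / ((n : ℝ) + 1) ^ (s + 1))
      (u := fun n => r ^ n) (g' := fun (n : ℕ) (y : ℝ) => y ^ n / ((n : ℝ) + 1) ^ s)
      (summable_geometric_of_lt_one hr0 hr) Metric.isOpen_ball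
      (convex_ball (0 : ℝ) r).isPreconnected ?_ ?_ (by simpa using hxr)
      (summable_realPolylog (by omega) hx.le) (by simpa using hxr)
    · intro n y _
      have h := (hasDerivAt_pow (n + 1) y).div_const (((n : ℝ) + 1) ^ (s + 1))
      refine h.congr_deriv ?_
      have : ((n : ℝ) + 1) ≠ 0 := by positivity
      push_cast
      field_simp
      ring
    · intro n y hy
      have h1 : (1 : ℝ) ≤ ((n : ℝ) + 1) ^ s := one_le_pow₀ (by linarith [n.cast_nonneg (α := ℝ)])
      rw [norm_div, norm_pow, Real.norm_eq_abs, Real.norm_eq_abs,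
        abs_of_pos (zero_lt_one.trans_le h1)]
      calc |y| ^ n / ((n : ℝ) + 1) ^ s ≤ |y| ^ n / 1 := by gcongr
        _ ≤ r ^ n := by rw [div_one]; exact pow_le_pow_left₀ (abs_nonneg y) (hmem hy).le n
  convert key using 1
  rw [realPolylog, ← tsum_div_const]
  refine tsum_congr fun n => ?_
  rw [pow_succ]
  field_simp

theorem eq_of_hasDerivAt_zero {f : ℝ → ℝ} {a b : ℝ} (hab : a < b)
    (hf : ContinuousOn f (Set.Icc a b)) (hf' : ∀ x ∈ Set.Ioo a b, HasDerivAt f 0 x) :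
    f b = f a := by
  obtain ⟨c, -, hc⟩ := exists_hasDerivAt_eq_slope f (fun _ => 0) hab hf hf'
  have h : b - a ≠ 0 := by linarith
  field_simp at hc
  linarith

/-! ### Functional equations on `[0, 1/2]` -/

theorem abs_neg_div_one_sub_lt_one {x : ℝ} (h0 : 0 < x) (h1 : x < 1 / 2) :
    |(-x / (1 - x))| < 1 := by
  rw [abs_div, abs_neg, abs_of_pos h0, abs_of_pos (by linarith), div_lt_one (by linarith)]
  linarith

theorem neg_div_one_sub_mem_Icc {x : ℝ} (hx : x ∈ Set.Icc (0 : ℝ) (1 / 2)) :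
    -x / (1 - x) ∈ Set.Icc (-1 : ℝ) 1 := by
  obtain ⟨h0, h1⟩ := hx
  constructor
  · rw [le_div_iff₀ (by linarith)]; linarith
  · rw [div_le_iff₀ (by linarith)]; linarith

theorem hasDerivAt_neg_div_one_sub {x : ℝ} (hx : 1 - x ≠ 0) :
    HasDerivAt (fun y : ℝ => -y / (1 - y)) (-1 / (1 - x) ^ 2) x := by
  have h := ((hasDerivAt_id x).neg).div ((hasDerivAt_id x).const_sub 1) hx
  refine h.congr_deriv ?_
  simp [id]

theorem hasDerivAt_log_one_sub {x : ℝ} (hx : 1 - x ≠ 0) :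
    HasDerivAt (fun y : ℝ => Real.log (1 - y)) (-1 / (1 - x)) x :=
  ((hasDerivAt_id x).const_sub 1).log hx

theorem continuousOn_log_one_sub :
    ContinuousOn (fun y : ℝ => Real.log (1 - y)) (Set.Icc 0 (1 / 2)) :=
  ContinuousOn.log (by fun_prop) fun x hx => by linarith [hx.2]

/-- Only `0` is delicate: there `log (1 - y) = O(y)` and `y log y → 0`, matching the value given by
`Real.log 0 = 0`. -/
theorem continuousOn_log_one_sub_mul_log :
    ContinuousOn (fun y : ℝ => Real.log (1 - y) * Real.log y) (Set.Icc 0 (1 / 2)) := by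
  intro x hx
  rcases hx.1.eq_or_lt with rfl | h0
  · refine ContinuousAt.continuousWithinAt ?_
    have h1 : (fun y : ℝ => Real.log (1 - y)) =O[𝓝 0] fun y => y := by
      simpa using (hasDerivAt_log_one_sub (x := 0) (by norm_num)).isBigO_sub
    have h2 := h1.mul (Asymptotics.isBigO_refl Real.log (𝓝 0))
    have h3 : Tendsto (fun y : ℝ => y * Real.log y) (𝓝 0) (𝓝 0) := by
      simpa using Real.continuous_mul_log.tendsto 0
    simpa [ContinuousAt] using h2.trans_tendsto h3
  · exact (continuousOn_log_one_sub x hx).mul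
      (Real.continuousAt_log h0.ne').continuousWithinAt

theorem continuousOn_realPolylog_comp {s : ℕ} (hs : 2 ≤ s) {f : ℝ → ℝ} {t : Set ℝ}
    (hf : ContinuousOn f t) (hm : Set.MapsTo f t (Set.Icc (-1) 1)) :
    ContinuousOn (fun x => realPolylog s (f x)) t :=
  (continuousOn_realPolylog hs).comp hf hm

theorem continuousOn_realPolylog_Icc_half {s : ℕ} (hs : 2 ≤ s) :
    ContinuousOn (realPolylog s) (Set.Icc 0 (1 / 2)) :=
  (continuousOn_realPolylog hs).mono (Set.Icc_subset_Icc (by norm_num) (by norm_num))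

theorem continuousOn_realPolylog_one_sub {s : ℕ} (hs : 2 ≤ s) :
    ContinuousOn (fun x => realPolylog s (1 - x)) (Set.Icc 0 (1 / 2)) :=
  continuousOn_realPolylog_comp hs (by fun_prop) fun x hx =>
    ⟨by linarith [hx.2], by linarith [hx.1]⟩

theorem continuousOn_realPolylog_neg_div {s : ℕ} (hs : 2 ≤ s) :
    ContinuousOn (fun x => realPolylog s (-x / (1 - x))) (Set.Icc 0 (1 / 2)) :=
  continuousOn_realPolylog_comp hs
    (ContinuousOn.div (by fun_prop) (by fun_prop) fun x hx => by linarith [hx.2])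
    fun _ hx => neg_div_one_sub_mem_Icc hx

theorem hasDerivAt_realPolylog_one_sub {s : ℕ} (hs : 1 ≤ s) {x : ℝ} (h0 : 0 < x) (h1 : x < 1) :
    HasDerivAt (fun y => realPolylog (s + 1) (1 - y)) (-(realPolylog s (1 - x) / (1 - x))) x := by
  have h := (hasDerivAt_realPolylog_succ hs (x := 1 - x)
    (by rw [abs_lt]; constructor <;> linarith) (by linarith)).comp x
    ((hasDerivAt_id x).const_sub 1)
  refine h.congr_deriv ?_
  ring

theorem hasDerivAt_realPolylog_neg_div {s : ℕ} (hs : 1 ≤ s) {x : ℝ} (h0 : 0 < x)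
    (h1 : x < 1 / 2) :
    HasDerivAt (fun y => realPolylog (s + 1) (-y / (1 - y)))
      (realPolylog s (-x / (1 - x)) * (1 / x + 1 / (1 - x))) x := by
  have h2 : 1 - x ≠ 0 := by linarith
  have h := (hasDerivAt_realPolylog_succ hs (abs_neg_div_one_sub_lt_one h0 h1)
    (div_ne_zero (neg_ne_zero.2 h0.ne') h2)).comp x (hasDerivAt_neg_div_one_sub h2)
  refine h.congr_deriv ?_
  have := h0.ne'
  field_simp
  ring

/-- Landen's identity for the dilogarithm. -/
theorem realPolylog_two_landen {x : ℝ} (h0 : 0 < x) (h1 : x < 1 / 2) :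
    realPolylog 2 x + realPolylog 2 (-x / (1 - x)) = -(Real.log (1 - x) ^ 2 / 2) := by
  have hsub : Set.Icc 0 x ⊆ Set.Icc (0 : ℝ) (1 / 2) := Set.Icc_subset_Icc le_rfl h1.le
  have h := eq_of_hasDerivAt_zero (a := 0) (b := x)
    (f := fun y => realPolylog 2 y + realPolylog 2 (-y / (1 - y)) + Real.log (1 - y) ^ 2 / 2) h0
    (ContinuousOn.mono (((continuousOn_realPolylog_Icc_half le_rfl).add
      (continuousOn_realPolylog_neg_div le_rfl)).add
      ((continuousOn_log_one_sub.pow 2).div_const 2)) hsub) ?_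
  · simp only [neg_zero, zero_div, sub_zero, realPolylog_zero_right, Real.log_one] at h
    linarith
  · rintro y ⟨hy0, hyx⟩
    have hy1 : y < 1 / 2 := hyx.trans h1
    have hy2 : 1 - y ≠ 0 := by linarith
    have hd := ((hasDerivAt_realPolylog_succ (s := 1) le_rfl (x := y)
      (by rw [abs_lt]; constructor <;> linarith) hy0.ne').add
      (hasDerivAt_realPolylog_neg_div (s := 1) le_rfl hy0 hy1)).add
      (((hasDerivAt_log_one_sub hy2).pow 2).div_const 2)
    refine hd.congr_deriv (Eq.symm ?_)
    rw [realPolylog_one_left (x := y) (by rw [abs_lt]; constructor <;> linarith),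
      realPolylog_one_left (abs_neg_div_one_sub_lt_one hy0 hy1)]
    have : 1 - -y / (1 - y) = (1 - y)⁻¹ := by field_simp; ring
    rw [this, Real.log_inv]
    have := hy0.ne'
    field_simp
    ring

/-- Euler's reflection formula for the dilogarithm. -/
theorem realPolylog_two_reflection {x : ℝ} (h0 : 0 < x) (h1 : x < 1 / 2) :
    realPolylog 2 x + realPolylog 2 (1 - x) =
      realPolylog 2 1 - Real.log (1 - x) * Real.log x := by
  have hsub : Set.Icc 0 x ⊆ Set.Icc (0 : ℝ) (1 / 2) := Set.Icc_subset_Icc le_rfl h1.le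
  have h := eq_of_hasDerivAt_zero (a := 0) (b := x)
    (f := fun y => realPolylog 2 y + realPolylog 2 (1 - y) + Real.log (1 - y) * Real.log y) h0
    (ContinuousOn.mono (((continuousOn_realPolylog_Icc_half le_rfl).add
      (continuousOn_realPolylog_one_sub le_rfl)).add continuousOn_log_one_sub_mul_log) hsub) ?_
  · simp only [sub_zero, realPolylog_zero_right, Real.log_one] at h
    linarith
  · rintro y ⟨hy0, hyx⟩
    have hy1 : y < 1 / 2 := hyx.trans h1
    have hy2 : 1 - y ≠ 0 := by linarith
    have hd := ((hasDerivAt_realPolylog_succ (s := 1) le_rfl (x := y)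
      (by rw [abs_lt]; constructor <;> linarith) hy0.ne').add
      (hasDerivAt_realPolylog_one_sub (s := 1) le_rfl hy0 (by linarith))).add
      ((hasDerivAt_log_one_sub hy2).mul (Real.hasDerivAt_log hy0.ne'))
    refine hd.congr_deriv (Eq.symm ?_)
    rw [realPolylog_one_left (x := y) (by rw [abs_lt]; constructor <;> linarith),
      realPolylog_one_left (x := 1 - y) (by rw [abs_lt]; constructor <;> linarith), sub_sub_cancel]
    have := hy0.ne'
    field_simp
    ring

/-- The three-term identity for the trilogarithm, specialized to `x = 1 / 2`. -/
theorem two_mul_realPolylog_three_half_add :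
    2 * realPolylog 3 (1 / 2) + realPolylog 3 (-1) =
      realPolylog 3 1 - realPolylog 2 1 * Real.log 2 + Real.log 2 ^ 3 / 3 := by
  have h := eq_of_hasDerivAt_zero (a := 0) (b := 1 / 2)
    (f := fun y => realPolylog 3 y + realPolylog 3 (1 - y) + realPolylog 3 (-y / (1 - y))
      - Real.log (1 - y) ^ 3 / 6 - realPolylog 2 1 * Real.log (1 - y)
      + Real.log (1 - y) * (Real.log (1 - y) * Real.log y) / 2) (by norm_num)
    ((((((continuousOn_realPolylog_Icc_half (by norm_num)).add
      (continuousOn_realPolylog_one_sub (by norm_num))).add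
      (continuousOn_realPolylog_neg_div (by norm_num))).sub
      ((continuousOn_log_one_sub.pow 3).div_const 6)).sub
      (continuousOn_const.mul continuousOn_log_one_sub)).add
      ((continuousOn_log_one_sub.mul continuousOn_log_one_sub_mul_log).div_const 2)) ?_
  · have e1 : (1 : ℝ) - 1 / 2 = 1 / 2 := by norm_num
    have e2 : -(1 / 2 : ℝ) / (1 / 2) = -1 := by norm_num
    have e3 : Real.log (1 / 2) = -Real.log 2 := by rw [one_div, Real.log_inv]
    simp only [e1, e2, e3, neg_zero, zero_div, sub_zero, realPolylog_zero_right,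
      Real.log_one] at h
    linarith
  · rintro y ⟨hy0, hy1⟩
    have hy2 : 1 - y ≠ 0 := by linarith
    have hl := hasDerivAt_log_one_sub hy2
    have hd := (((((hasDerivAt_realPolylog_succ (s := 2) (by norm_num) (x := y)
      (by rw [abs_lt]; constructor <;> linarith) hy0.ne').add
      (hasDerivAt_realPolylog_one_sub (s := 2) (by norm_num) hy0 (by linarith))).add
      (hasDerivAt_realPolylog_neg_div (s := 2) (by norm_num) hy0 hy1)).sub
      ((hl.pow 3).div_const 6)).sub (hl.const_mul (realPolylog 2 1))).add
      ((hl.mul (hl.mul (Real.hasDerivAt_log hy0.ne'))).div_const 2)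
    refine hd.congr_deriv (Eq.symm ?_)
    -- Landen and reflection leave `Li₂ y` as the only dilogarithm, and its coefficients cancel.
    have hA : realPolylog 2 (-y / (1 - y)) = -(Real.log (1 - y) ^ 2 / 2) - realPolylog 2 y := by
      linarith [realPolylog_two_landen hy0 hy1]
    have hB : realPolylog 2 (1 - y) =
        realPolylog 2 1 - Real.log (1 - y) * Real.log y - realPolylog 2 y := by
      linarith [realPolylog_two_reflection hy0 hy1]
    rw [hA, hB, Pi.mul_apply]
    have := hy0.ne'
    field_simp
    ring

/-! ### Special values and the zeta function -/

theorem realPolylog_three_neg_one : realPolylog 3 (-1) = -(3 / 4) * realPolylog 3 1 := by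
  have hp := summable_realPolylog (s := 3) (by norm_num) (x := 1) (by simp)
  have hm := summable_realPolylog (s := 3) (by norm_num) (x := -1) (by simp)
  have hinj : Function.Injective fun n : ℕ => 2 * n + 1 := fun a b h => by
    simp only at h; omega
  have hsum : realPolylog 3 1 + realPolylog 3 (-1) = ∑' n : ℕ, 1 / 4 * (1 / ((n : ℝ) + 1) ^ 3) := by
    rw [realPolylog, realPolylog, ← hp.tsum_add hm]
    -- Odd indices carry the even denominators `2(k+1)`; the other terms of `Li₃(1) + Li₃(-1)`
    -- cancel.
    rw [← hinj.tsum_eq]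
    · refine tsum_congr fun n => ?_
      have e : (-1 : ℝ) ^ (2 * n + 1 + 1) = 1 := Even.neg_one_pow ⟨n + 1, by ring⟩
      simp only [e, one_pow]
      push_cast
      have : (n : ℝ) + 1 ≠ 0 := by positivity
      have h2 : (2 * n + 1 + 1 : ℝ) = 2 * (n + 1) := by ring
      rw [h2]
      field_simp
      norm_num
    · intro n hn
      rcases Nat.even_or_odd n with he | ho
      · exact absurd (by simp [he.add_one.neg_one_pow]; ring) hn
      · obtain ⟨k, hk⟩ := ho
        exact ⟨k, hk.symm⟩
  rw [tsum_mul_left] at hsum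
  have : realPolylog 3 1 = ∑' n : ℕ, 1 / ((n : ℝ) + 1) ^ 3 := by simp [realPolylog]
  rw [← this] at hsum
  linarith

theorem two_mul_realPolylog_three_half :
    2 * realPolylog 3 (1 / 2) =
      7 / 4 * realPolylog 3 1 - realPolylog 2 1 * Real.log 2 + 1 / 3 * Real.log 2 ^ 3 := by
  have h := two_mul_realPolylog_three_half_add
  rw [realPolylog_three_neg_one] at h
  linarith

theorem riemannZeta_natCast_eq_realPolylog {s : ℕ} (hs : 2 ≤ s) :
    riemannZeta s = ((realPolylog s 1 : ℝ) : ℂ) := by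
  rw [zeta_nat_eq_tsum_of_gt_one (by omega), realPolylog, Complex.ofReal_tsum,
    Summable.tsum_eq_zero_add]
  · simp [show s ≠ 0 by omega]
  · have h := Complex.ofRealCLM.summable
      (Real.summable_one_div_nat_pow.2 (show 1 < s by omega))
    simpa using h

/-! ### Log-moment integrals -/

theorem continuousOn_mul_log_sq :
    ContinuousOn (fun t : ℝ => t * Real.log t ^ 2) (Set.Icc 0 1) := by
  have h : Continuous fun t : ℝ => 4 * (Real.sqrt t * Real.log (Real.sqrt t)) ^ 2 :=
    continuous_const.mul ((Real.continuous_mul_log.comp Real.continuous_sqrt).pow 2)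
  refine h.continuousOn.congr fun t ht => ?_
  simp only
  rw [Real.log_sqrt ht.1, mul_pow, Real.sq_sqrt ht.1]
  ring

/-- A nonnegative derivative of a function continuous up to the endpoints is integrable. -/
theorem intervalIntegrable_log_sq :
    IntervalIntegrable (fun t : ℝ => Real.log t ^ 2) MeasureTheory.volume 0 1 := by
  refine intervalIntegral.intervalIntegrable_deriv_of_nonneg
    (g := fun t => t * Real.log t ^ 2 - 2 * (t * Real.log t) + 2 * t) ?_ ?_ ?_
  · rw [Set.uIcc_of_le zero_le_one]
    exact (continuousOn_mul_log_sq.sub (Real.continuous_mul_log.const_mul 2).continuousOn).add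
      (by fun_prop)
  · intro x hx
    have hx0 : x ≠ 0 := by
      have := hx.1
      simp at this
      exact this.ne'
    have hl := Real.hasDerivAt_log hx0
    have h := (((hasDerivAt_id x).mul (hl.pow 2)).sub
      (((hasDerivAt_id x).mul hl).const_mul 2)).add ((hasDerivAt_id x).const_mul 2)
    refine h.congr_deriv ?_
    simp only [id, Pi.pow_apply]
    field_simp
    ring
  · intro x _
    positivity

theorem intervalIntegrable_mul_log_sq {f : ℝ → ℝ} (hf : ContinuousOn f (Set.Icc 0 1)) :
    IntervalIntegrable (fun t => f t * Real.log t ^ 2) MeasureTheory.volume 0 1 :=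
  intervalIntegrable_log_sq.continuousOn_mul (by rwa [Set.uIcc_of_le zero_le_one])

theorem intervalIntegrable_mul_log {f : ℝ → ℝ} (hf : Continuous f) :
    IntervalIntegrable (fun t => f t * Real.log t) MeasureTheory.volume 0 1 :=
  intervalIntegral.intervalIntegrable_log'.continuousOn_mul hf.continuousOn

/-- Integrates the derivative of `t f(t) log² t`, which vanishes at both ends. -/
theorem integral_deriv_mul_log_sq {f f' : ℝ → ℝ} (hf : ∀ t, HasDerivAt f (f' t) t)
    (hf' : Continuous f') :
    ∫ t in (0 : ℝ)..1, (f t + t * f' t) * Real.log t ^ 2 =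
      -2 * ∫ t in (0 : ℝ)..1, f t * Real.log t := by
  have hc : Continuous f := continuous_iff_continuousAt.2 fun t => (hf t).continuousAt
  have i1 := intervalIntegrable_mul_log_sq (f := fun t => f t + t * f' t) (by fun_prop)
  have i2 := (intervalIntegrable_mul_log hc).const_mul 2
  have h := intervalIntegral.integral_eq_sub_of_hasDerivAt_of_le zero_le_one
    (f := fun t => f t * (t * Real.log t ^ 2)) (hc.continuousOn.mul continuousOn_mul_log_sq)
    (f' := fun t => (f t + t * f' t) * Real.log t ^ 2 + 2 * (f t * Real.log t)) ?_ (i1.add i2)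
  · rw [intervalIntegral.integral_add i1 i2, intervalIntegral.integral_const_mul] at h
    simp only [Real.log_one, zero_mul] at h
    linarith
  · intro x hx
    have hx0 : x ≠ 0 := hx.1.ne'
    refine ((hf x).mul ((hasDerivAt_id x).mul ((Real.hasDerivAt_log hx0).pow 2))).congr_deriv ?_
    simp only [id, Pi.pow_apply, Pi.mul_apply]
    field_simp
    ring

theorem integral_deriv_mul_log {f f' : ℝ → ℝ} (hf : ∀ t, HasDerivAt f (f' t) t)
    (hf' : Continuous f') :
    ∫ t in (0 : ℝ)..1, (f t + t * f' t) * Real.log t = -∫ t in (0 : ℝ)..1, f t := by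
  have hc : Continuous f := continuous_iff_continuousAt.2 fun t => (hf t).continuousAt
  have i1 := intervalIntegrable_mul_log (f := fun t => f t + t * f' t) (by fun_prop)
  have i2 := hc.intervalIntegrable (μ := MeasureTheory.volume) 0 1
  have h := intervalIntegral.integral_eq_sub_of_hasDerivAt_of_le zero_le_one
    (f := fun t => f t * (t * Real.log t)) (hc.mul Real.continuous_mul_log).continuousOn
    (f' := fun t => (f t + t * f' t) * Real.log t + f t) ?_ (i1.add i2)
  · rw [intervalIntegral.integral_add i1 i2] at h
    simp only [Real.log_one, zero_mul] at h
    linarith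
  · intro x hx
    have hx0 : x ≠ 0 := hx.1.ne'
    refine ((hf x).mul ((hasDerivAt_id x).mul (Real.hasDerivAt_log hx0))).congr_deriv ?_
    simp only [id, Pi.mul_apply]
    field_simp
    ring

theorem integral_pow_mul_log_sq (k : ℕ) :
    ∫ t in (0 : ℝ)..1, t ^ k * Real.log t ^ 2 = 2 / ((k : ℝ) + 1) ^ 3 := by
  have e (t : ℝ) : t ^ k + t * (k * t ^ (k - 1)) = ((k : ℝ) + 1) * t ^ k := by
    cases k with
    | zero => simp
    | succ m => push_cast; ring
  have h2 := integral_deriv_mul_log_sq (f := fun t => t ^ k) (fun t => hasDerivAt_pow k t)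
    (by fun_prop)
  have h1 := integral_deriv_mul_log (f := fun t => t ^ k) (fun t => hasDerivAt_pow k t)
    (by fun_prop)
  simp only [e, mul_assoc, intervalIntegral.integral_const_mul, integral_pow] at h1 h2
  have hk : (k : ℝ) + 1 ≠ 0 := by positivity
  simp only [one_pow, ne_eq, Nat.add_eq_zero_iff, one_ne_zero, and_false, not_false_eq_true,
    zero_pow, sub_zero] at h1
  rw [eq_div_iff (pow_ne_zero 3 hk)]
  field_simp at h1
  linear_combination (k + 1 : ℝ) ^ 2 * h2 - 2 * h1

theorem hasDerivAt_one_sub_pow (n : ℕ) (t : ℝ) :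
    HasDerivAt (fun t : ℝ => (1 - t) ^ n) (-(n * (1 - t) ^ (n - 1))) t := by
  refine (((hasDerivAt_id t).const_sub 1).pow n).congr_deriv ?_
  simp

/-- Makes the integration by parts a recurrence between consecutive powers of `1 - t`. -/
theorem one_sub_pow_succ_add_mul_deriv (n : ℕ) (t : ℝ) :
    (1 - t) ^ (n + 1) + t * -(((n + 1 : ℕ) : ℝ) * (1 - t) ^ (n + 1 - 1)) =
      ((n : ℝ) + 2) * (1 - t) ^ (n + 1) - ((n : ℝ) + 1) * (1 - t) ^ n := by
  simp only [Nat.add_sub_cancel]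
  push_cast
  ring

theorem integral_one_sub_pow (n : ℕ) :
    ∫ t in (0 : ℝ)..1, (1 - t) ^ n = 1 / ((n : ℝ) + 1) := by
  rw [intervalIntegral.integral_comp_sub_left (fun t => t ^ n)]
  simp

theorem integral_one_sub_pow_mul_log (n : ℕ) :
    ((n : ℝ) + 1) * ∫ t in (0 : ℝ)..1, (1 - t) ^ n * Real.log t =
      -((harmonic (n + 1) : ℚ) : ℝ) := by
  induction n with
  | zero => simp
  | succ n ih =>
    have h := integral_deriv_mul_log (hasDerivAt_one_sub_pow (n + 1)) (by fun_prop)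
    simp only [one_sub_pow_succ_add_mul_deriv, sub_mul, mul_assoc] at h
    rw [intervalIntegral.integral_sub, intervalIntegral.integral_const_mul,
      intervalIntegral.integral_const_mul, integral_one_sub_pow, ih] at h
    · rw [harmonic_succ (n + 1)]
      push_cast at h ⊢
      rw [one_div] at h
      rw [show (n : ℝ) + 1 + 1 = n + 2 by ring] at h ⊢
      linarith
    · exact (intervalIntegrable_mul_log (by fun_prop)).const_mul _
    · exact (intervalIntegrable_mul_log (by fun_prop)).const_mul _

theorem generalizedHarmonic_succ (r n : ℕ) :
    generalizedHarmonic r (n + 1) = generalizedHarmonic r n + 1 / ((n : ℝ) + 1) ^ r := by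
  rw [generalizedHarmonic, Finset.sum_Icc_succ_top (by omega)]
  simp [generalizedHarmonic]

/-- Both sides grow by `2 H_{n+2}/(n+2)`: with `a = 1/(n+2)`, `H² - (H - a)² + a² = 2aH`. -/
theorem integral_one_sub_pow_mul_log_sq (n : ℕ) :
    ((n : ℝ) + 1) * ∫ t in (0 : ℝ)..1, (1 - t) ^ n * Real.log t ^ 2 =
      ((harmonic (n + 1) : ℚ) : ℝ) ^ 2 + generalizedHarmonic 2 (n + 1) := by
  induction n with
  | zero =>
    have h := integral_pow_mul_log_sq 0
    simp only [pow_zero, one_mul] at h ⊢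
    rw [h]
    norm_num [generalizedHarmonic]
  | succ n ih =>
    have h := integral_deriv_mul_log_sq (hasDerivAt_one_sub_pow (n + 1)) (by fun_prop)
    simp only [one_sub_pow_succ_add_mul_deriv, sub_mul, mul_assoc] at h
    rw [intervalIntegral.integral_sub, intervalIntegral.integral_const_mul,
      intervalIntegral.integral_const_mul, ih] at h
    · have hJ := integral_one_sub_pow_mul_log (n + 1)
      rw [generalizedHarmonic_succ 2 (n + 1)]
      rw [harmonic_succ (n + 1)] at hJ ⊢
      push_cast at h hJ ⊢
      rw [show (n : ℝ) + 1 + 1 = n + 2 by ring] at hJ ⊢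
      have hn : (n : ℝ) + 2 ≠ 0 := by positivity
      rw [mul_comm, ← eq_div_iff hn] at hJ
      rw [hJ] at h
      rw [sub_eq_iff_eq_add] at h
      rw [h]
      field_simp
      ring
    · exact (intervalIntegrable_mul_log_sq (by fun_prop)).const_mul _
    · exact (intervalIntegrable_mul_log_sq (by fun_prop)).const_mul _

/-! ### Summing under the integral -/

theorem tendsto_sum_integral_pow_mul_log_sq {r : ℝ → ℝ} (hr : Continuous r)
    (hr1 : ∀ t ∈ Set.Ioo (0 : ℝ) 1, |r t| < 1) (hr2 : ∀ t ∈ Set.Ioo (0 : ℝ) 1, r t ≤ 1 / 2) :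
    Tendsto (fun N => ∑ m ∈ Finset.range N, ∫ t in (0 : ℝ)..1, r t ^ m * Real.log t ^ 2) atTop
      (𝓝 (∫ t in (0 : ℝ)..1, (1 - r t)⁻¹ * Real.log t ^ 2)) := by
  have hint (m : ℕ) := intervalIntegrable_mul_log_sq (f := fun t => r t ^ m) (by fun_prop)
  have hsum (N : ℕ) : ∑ m ∈ Finset.range N, ∫ t in (0 : ℝ)..1, r t ^ m * Real.log t ^ 2 =
      ∫ t in (0 : ℝ)..1, (∑ m ∈ Finset.range N, r t ^ m) * Real.log t ^ 2 := by
    rw [← intervalIntegral.integral_finsetSum fun m _ => hint m]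
    simp only [Finset.sum_mul]
  simp only [hsum]
  have hae : ∀ᵐ t : ℝ, t ∈ Set.uIoc (0 : ℝ) 1 → t ∈ Set.Ioo (0 : ℝ) 1 := by
    filter_upwards [MeasureTheory.Measure.ae_ne MeasureTheory.volume (1 : ℝ)] with t ht htm
    rw [Set.uIoc_of_le zero_le_one] at htm
    exact ⟨htm.1, lt_of_le_of_ne htm.2 ht⟩
  refine intervalIntegral.tendsto_integral_filter_of_dominated_convergence
    -- Geometric partial sums satisfy `|1 - r^N| / (1 - r) ≤ 2 / (1/2) = 4`.
    (fun t => 4 * Real.log t ^ 2) (Eventually.of_forall fun N => ?_)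
    (Eventually.of_forall fun N => ?_) (intervalIntegrable_log_sq.const_mul 4) ?_
  · exact ((intervalIntegrable_mul_log_sq (by fun_prop)).def').aestronglyMeasurable
  · filter_upwards [hae] with t ht htm
    have h1 := hr1 t (ht htm)
    have h2 := hr2 t (ht htm)
    rw [norm_mul, norm_pow, Real.norm_eq_abs, Real.norm_eq_abs, sq_abs]
    gcongr
    have h0 : 0 < 1 - r t := by linarith
    rw [geom_sum_eq (by linarith), abs_div, abs_sub_comm (r t), abs_of_pos h0, div_le_iff₀ h0]
    have h3 : |r t ^ N| ≤ 1 := by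
      rw [abs_pow]; exact pow_le_one₀ (abs_nonneg _) h1.le
    rw [abs_le] at h3 ⊢
    constructor <;> linarith
  · filter_upwards [hae] with t ht htm
    exact (hasSum_geometric_of_abs_lt_one (hr1 t (ht htm))).tendsto_sum_nat.mul_const _

theorem integral_inv_two_sub_mul_log_sq :
    ∫ t in (0 : ℝ)..1, (2 - t)⁻¹ * Real.log t ^ 2 = 2 * realPolylog 3 (1 / 2) := by
  have h1 := tendsto_sum_integral_pow_mul_log_sq (r := fun t => t / 2) (by fun_prop)
    (fun t ht => by rw [abs_lt]; constructor <;> linarith [ht.1, ht.2])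
    (fun t ht => by linarith [ht.2])
  have h2 := ((summable_realPolylog (s := 3) (by norm_num) (x := 1 / 2)
    (by rw [abs_le]; norm_num)).hasSum.mul_left 4).tendsto_sum_nat
  have he (m : ℕ) : ∫ t in (0 : ℝ)..1, (t / 2) ^ m * Real.log t ^ 2 =
      4 * ((1 / 2) ^ (m + 1) / ((m : ℝ) + 1) ^ 3) := by
    have : (fun t : ℝ => (t / 2) ^ m * Real.log t ^ 2) =
        fun t => (1 / 2) ^ m * (t ^ m * Real.log t ^ 2) := by
      funext t; rw [div_eq_mul_one_div, mul_pow]; ring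
    rw [this, intervalIntegral.integral_const_mul, integral_pow_mul_log_sq, pow_succ]
    ring
  simp only [he] at h1
  have h3 := tendsto_nhds_unique h1 h2
  have h4 : (fun t : ℝ => (1 - t / 2)⁻¹ * Real.log t ^ 2) =
      fun t => 2 * ((2 - t)⁻¹ * Real.log t ^ 2) := by
    funext t
    rw [show 1 - t / 2 = (2 - t) / 2 by ring, inv_div]
    ring
  rw [h4, intervalIntegral.integral_const_mul] at h3
  change _ = 4 * realPolylog 3 (1 / 2) at h3
  linarith

theorem tendsto_alternating_harmonic_sq_sum :
    Tendsto (fun N : ℕ => ∑ n ∈ Finset.Icc 1 N, (-1 : ℝ) ^ (n - 1) *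
      (((harmonic n : ℚ) : ℝ) ^ 2 + generalizedHarmonic 2 n) / (n : ℝ)) atTop
      (𝓝 (2 * realPolylog 3 (1 / 2))) := by
  -- The ratio `t - 1` tends to `-1` as `t → 0`, so the bounded partial sums, not absolute
  -- convergence, justify the interchange.
  have h := tendsto_sum_integral_pow_mul_log_sq (r := fun t => t - 1) (by fun_prop)
    (fun t ht => by rw [abs_lt]; constructor <;> linarith [ht.1, ht.2])
    (fun t ht => by linarith [ht.2])
  have e (t : ℝ) : 1 - (t - 1) = 2 - t := by ring
  simp only [e, integral_inv_two_sub_mul_log_sq] at h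
  refine h.congr fun N => ?_
  rw [← Finset.Ico_add_one_right_eq_Icc, Finset.sum_Ico_eq_sum_range, Nat.add_sub_cancel]
  refine Finset.sum_congr rfl fun m _ => ?_
  rw [Nat.add_sub_cancel_left, add_comm 1 m, ← integral_one_sub_pow_mul_log_sq]
  have hm : (m : ℝ) + 1 ≠ 0 := by positivity
  have h1 : (fun t : ℝ => (t - 1) ^ m * Real.log t ^ 2) =
      fun t => (-1) ^ m * ((1 - t) ^ m * Real.log t ^ 2) := by
    funext t
    rw [← mul_assoc, ← mul_pow]
    ring
  rw [h1, intervalIntegral.integral_const_mul]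
  push_cast
  field_simp

theorem mainTheorem10 :
    Tendsto
      (fun N : ℕ =>
        ((∑ n ∈ Finset.Icc 1 N,
            (-1 : ℝ) ^ (n - 1) *
              (((harmonic n : ℚ) : ℝ) ^ 2 + generalizedHarmonic 2 n) / (n : ℝ) : ℝ) : ℂ))
      atTop
      (𝓝 ((7 / 4 : ℂ) * riemannZeta 3 - riemannZeta 2 * (Real.log 2 : ℂ)
        + (1 / 3 : ℂ) * (Real.log 2 : ℂ) ^ 3)) := by
  have h := (Complex.continuous_ofReal.tendsto _).comp tendsto_alternating_harmonic_sq_sum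
  rw [two_mul_realPolylog_three_half] at h
  have h2 := riemannZeta_natCast_eq_realPolylog (s := 2) le_rfl
  have h3 := riemannZeta_natCast_eq_realPolylog (s := 3) (by norm_num)
  push_cast at h2 h3
  rw [h2, h3]
  refine Eq.mp (congrArg _ (congrArg 𝓝 ?_)) h
  push_cast
  rfl
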